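/- Let $\mathcal A$ be a nonzero (not necessarily unital) complex $C^*$-algebra and let $a,b\in\mathcal A$. Write $\mathbb T=\{\lambda\in\mathbb C:|\lambda|=1\}$. A state of $\mathcal A$ is a linear functional $\varphi:\mathcal A\to\mathbb C$ of norm one with $\varphi(c^*c)\ge 0$ for all $c\in\mathcal A$; a representation of $\mathcal A$ on a complex Hilbert space $\mathcal H$ is a $*$-homomorphism $\pi:\mathcal A\to\mathbb B(\mathcal H)$ into the bounded linear operators on $\mathcal H$. Then the following statements are equivalent: (i) $a\parallel b$, that is, $\|a+\lambda b\|=\|a\|+\|b\|$ for some $\lambda\in\mathbb T$; (ii) there exist a state $\varphi$ of $\mathcal A$ and $\lambda\in\mathbb T$ such that $\varphi(a^*b)=\lambda\|a\|\|b\|$; (iii) there exist a complex Hilbert space $\mathcal H$ with inner product $(\cdot\mid\cdot)$ (linear in the first variable), a representation $\pi:\mathcal A\to\mathbb B(\mathcal H)$, a unit vector $\xi\in\mathcal H$ and $\lambda\in\mathbb T$ such that $\|\pi(a)\xi\|=\|a\|$ and $(\pi(a)\xi\mid\pi(b)\xi)=\lambda\|a\|\|b\|$. -/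

import Mathlib

/-!
A unital functional `f` of norm at most one on a unital C⋆-algebra is positive, and a functional
norming `1 + x` with `0 ≤ x` satisfies `f 1 = 1` and `f x = ‖x‖`. The GNS construction on the
unitization therefore yields, for every `c`, a representation `π` and a unit vector `ξ` with
`‖π c ξ‖ = ‖c‖`. For `c = a + l b` with `‖c‖ = ‖a‖ + ‖b‖` the triangle inequality for `π a ξ` and
`l π b ξ` is then an equality between vectors of full length, which in a Hilbert space determines
their inner product. The vector functional of `ξ` is a state as soon as `ξ` norms some nonzero
element. Finally, Cauchy–Schwarz in the GNS space of a state `φ` turns `φ (a⋆ b) = l ‖a‖ ‖b‖` into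
the equality case, so that the classes of `a` and `b` again have full length and their norms add.
-/

universe u v

open scoped ComplexOrder

namespace CStarParallel

/-- `x ∥ y` in a complex normed space: `‖x + l y‖ = ‖x‖ + ‖y‖` for some unimodular `l`. -/
def Parallel {V : Type*} [NormedAddCommGroup V] [NormedSpace ℂ V] (x y : V) : Prop :=
  ∃ l : ℂ, ‖l‖ = 1 ∧ ‖x + l • y‖ = ‖x‖ + ‖y‖

/-- A state of a (not necessarily unital) C⋆-algebra: a linear functional of norm one that is
nonnegative on the positive elements, that is, on the elements of the form `c⋆ c`. -/
def IsState {A : Type*} [NonUnitalCStarAlgebra A] (φ : A →L[ℂ] ℂ) : Prop :=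
  ‖φ‖ = 1 ∧ ∀ c : A, 0 ≤ φ (star c * c)

end CStarParallel

namespace CStarParallel

section InnerProduct

variable {𝕜 : Type*} [RCLike 𝕜]

lemma eq_ofReal_of_norm_le_of_le_re {z : 𝕜} {r : ℝ} (hz : ‖z‖ ≤ r) (hr : r ≤ RCLike.re z) :
    z = r := by
  rw [RCLike.norm_le_re_iff_eq_norm.1 (hz.trans hr), hz.antisymm (hr.trans (RCLike.re_le_norm z))]

lemma eq_ofReal_and_eq_ofReal_of_add_eq {z w : 𝕜} {r s : ℝ} (hz : ‖z‖ ≤ r) (hw : ‖w‖ ≤ s)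
    (h : z + w = (r + s : ℝ)) : z = r ∧ w = s := by
  have hre : RCLike.re z + RCLike.re w = r + s := by
    rw [← map_add, h, RCLike.ofReal_re]
  have hz' : RCLike.re z ≤ r := (RCLike.re_le_norm z).trans hz
  have hw' : RCLike.re w ≤ s := (RCLike.re_le_norm w).trans hw
  exact ⟨eq_ofReal_of_norm_le_of_le_re hz (by linarith),
    eq_ofReal_of_norm_le_of_le_re hw (by linarith)⟩

variable {E : Type*} [SeminormedAddCommGroup E] [InnerProductSpace 𝕜 E]

lemma norm_add_eq_iff_inner_eq {x y : E} :
    ‖x + y‖ = ‖x‖ + ‖y‖ ↔ inner 𝕜 x y = (‖x‖ * ‖y‖ : ℝ) := by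
  have hre : ‖x + y‖ = ‖x‖ + ‖y‖ ↔ RCLike.re (inner 𝕜 x y) = ‖x‖ * ‖y‖ := by
    rw [← sq_eq_sq₀ (norm_nonneg _) (by positivity), norm_add_sq (𝕜 := 𝕜)]
    constructor <;> intro h <;> linarith
  exact hre.trans ⟨fun h ↦ eq_ofReal_of_norm_le_of_le_re (norm_inner_le_norm x y) h.ge,
    fun h ↦ by rw [h, RCLike.ofReal_re]⟩

lemma norm_eq_and_norm_eq_of_norm_inner_eq {x y : E} {r s : ℝ} (hr : 0 < r) (hs : 0 < s)
    (hx : ‖x‖ ≤ r) (hy : ‖y‖ ≤ s) (h : ‖inner 𝕜 x y‖ = r * s) : ‖x‖ = r ∧ ‖y‖ = s := by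
  have hle : r * s ≤ ‖x‖ * ‖y‖ := h ▸ norm_inner_le_norm x y
  have hrx : r * s ≤ ‖x‖ * s := hle.trans (mul_le_mul_of_nonneg_left hy (norm_nonneg x))
  have hsy : r * s ≤ r * ‖y‖ := hle.trans (mul_le_mul_of_nonneg_right hx (norm_nonneg y))
  exact ⟨hx.antisymm (le_of_mul_le_mul_right hrx hs), hy.antisymm (le_of_mul_le_mul_left hsy hr)⟩

/-- `ULift E` with the inner product of `E`, used to place a Hilbert space constructed in the
universe of the algebra into a larger one. -/
noncomputable instance instInnerProductSpaceULift : InnerProductSpace 𝕜 (ULift E) where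
  inner x y := inner 𝕜 x.down y.down
  norm_sq_eq_re_inner x := norm_sq_eq_re_inner x.down
  conj_inner_symm x y := inner_conj_symm x.down y.down
  add_left x y z := inner_add_left x.down y.down z.down
  smul_left x y r := inner_smul_left x.down y.down r

end InnerProduct

section Contraction

variable {V E F : Type*} [NormedAddCommGroup V] [NormedSpace ℂ V] [SeminormedAddCommGroup E]
  [InnerProductSpace ℂ E] [FunLike F V E] [LinearMapClass F ℂ V E] {T : F} {x y : V} {l : ℂ}

lemma parallel_zero_left (y : V) : Parallel 0 y :=
  ⟨1, by simp, by simp⟩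

lemma parallel_zero_right (x : V) : Parallel x 0 :=
  ⟨1, by simp, by simp⟩

lemma norm_map_eq_and_inner_map_eq_of_norm_map_add_smul (hT : ∀ v, ‖T v‖ ≤ ‖v‖) (hl : ‖l‖ = 1)
    (h : ‖T (x + l • y)‖ = ‖x‖ + ‖y‖) :
    ‖T x‖ = ‖x‖ ∧ inner ℂ (T y) (T x) = l * ‖x‖ * ‖y‖ := by
  have hly : ‖l • T y‖ = ‖T y‖ := by rw [norm_smul, hl, one_mul]
  rw [map_add, map_smul] at h
  have htri : ‖x‖ + ‖y‖ ≤ ‖T x‖ + ‖T y‖ := by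
    rw [← h, ← hly]
    exact norm_add_le _ _
  have hx : ‖T x‖ = ‖x‖ := (hT x).antisymm (by linarith [hT y])
  have hy : ‖T y‖ = ‖y‖ := (hT y).antisymm (by linarith [hT x])
  have hinner : inner ℂ (l • T y) (T x) = (‖y‖ * ‖x‖ : ℝ) := by
    rw [← hx, ← hy, ← hly]
    refine norm_add_eq_iff_inner_eq.1 ?_
    rw [add_comm, h, hly, hx, hy, add_comm]
  refine ⟨hx, ?_⟩
  calc inner ℂ (T y) (T x)
      = l * starRingEnd ℂ l * inner ℂ (T y) (T x) := by simp [Complex.mul_conj', hl]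
    _ = l * inner ℂ (l • T y) (T x) := by rw [inner_smul_left, mul_assoc]
    _ = l * ‖x‖ * ‖y‖ := by rw [hinner]; push_cast; ring

lemma parallel_of_inner_map_eq (hT : ∀ v, ‖T v‖ ≤ ‖v‖) (hl : ‖l‖ = 1)
    (h : inner ℂ (T x) (T y) = l * ‖x‖ * ‖y‖) : Parallel x y := by
  obtain rfl | hx₀ := eq_or_ne x 0
  · exact parallel_zero_left y
  obtain rfl | hy₀ := eq_or_ne y 0
  · exact parallel_zero_right x
  have hnorm : ‖inner ℂ (T x) (T y)‖ = ‖x‖ * ‖y‖ := by simp [h, hl]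
  obtain ⟨hx, hy⟩ := norm_eq_and_norm_eq_of_norm_inner_eq (norm_pos_iff.2 hx₀)
    (norm_pos_iff.2 hy₀) (hT x) (hT y) hnorm
  have hly : ‖star l • T y‖ = ‖y‖ := by rw [norm_smul, norm_star, hl, one_mul, hy]
  have hinner : inner ℂ (T x) (star l • T y) = (‖T x‖ * ‖star l • T y‖ : ℝ) := by
    rw [inner_smul_right, h, hx, hly, mul_assoc, ← mul_assoc]
    simp [Complex.conj_mul', hl]
  refine ⟨star l, by rw [norm_star, hl], le_antisymm ?_ ?_⟩
  · simpa [norm_smul, hl] using norm_add_le x (star l • y)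
  · calc ‖x‖ + ‖y‖ = ‖T x + star l • T y‖ := by rw [norm_add_eq_iff_inner_eq.2 hinner, hx, hly]
      _ = ‖T (x + star l • y)‖ := by rw [map_add, map_smul]
      _ ≤ ‖x + star l • y‖ := hT _

end Contraction

section Unital

variable {B : Type*} [CStarAlgebra B]

lemma norm_add_algebraMap_mul_I_sq_le {h : B} (hh : IsSelfAdjoint h) (t : ℝ) :
    ‖h + algebraMap ℂ B (t * Complex.I)‖ ^ 2 ≤ ‖h‖ ^ 2 + t ^ 2 := by
  obtain _ | _ := subsingleton_or_nontrivial B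
  · rw [Subsingleton.elim (h + _) 0, norm_zero, zero_pow two_ne_zero]
    positivity
  have hcomm : Commute h (algebraMap ℂ B (t * Complex.I)) := (Algebra.commutes _ h).symm
  have hstar : star (h + algebraMap ℂ B (t * Complex.I)) = h - algebraMap ℂ B (t * Complex.I) := by
    rw [star_add, hh.star_eq, ← algebraMap_star_comm]
    simp [sub_eq_add_neg]
  have hsq : (h - algebraMap ℂ B (t * Complex.I)) * (h + algebraMap ℂ B (t * Complex.I))
      = h * h + algebraMap ℂ B (t ^ 2) := by
    rw [← hcomm.mul_self_sub_mul_self_eq', ← map_mul, mul_mul_mul_comm, Complex.I_mul_I,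
      mul_neg_one, map_neg, sub_neg_eq_add, sq]
  rw [sq, ← CStarRing.norm_star_mul_self, hstar, hsq]
  calc ‖h * h + algebraMap ℂ B (t ^ 2)‖ ≤ ‖h * h‖ + ‖algebraMap ℂ B (t ^ 2)‖ := norm_add_le _ _
    _ ≤ ‖h‖ ^ 2 + t ^ 2 := by
      gcongr
      · exact (norm_mul_le h h).trans_eq (sq ‖h‖).symm
      · rw [norm_algebraMap']
        simp

section UnitalFunctional

variable {f : B →L[ℂ] ℂ} (hf : ‖f‖ ≤ 1) (hf₁ : f 1 = 1)
include hf hf₁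

lemma im_apply_eq_zero_of_isSelfAdjoint {h : B} (hh : IsSelfAdjoint h) : (f h).im = 0 := by
  have hbound (t : ℝ) : 2 * t * (f h).im + (f h).im ^ 2 ≤ ‖h‖ ^ 2 := by
    have hshift : (f (h + algebraMap ℂ B (t * Complex.I))).im = (f h).im + t := by
      simp [Algebra.algebraMap_eq_smul_one, hf₁]
    have hle : |(f h).im + t| ≤ ‖h + algebraMap ℂ B (t * Complex.I)‖ := by
      rw [← hshift]
      exact (Complex.abs_im_le_norm _).trans ((f.le_of_opNorm_le hf _).trans_eq (one_mul _))
    have hsq : ((f h).im + t) ^ 2 ≤ ‖h‖ ^ 2 + t ^ 2 :=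
      (sq_le_sq.2 (hle.trans (le_abs_self _))).trans (norm_add_algebraMap_mul_I_sq_le hh t)
    linarith
  by_contra him
  have hlarge := hbound (‖h‖ ^ 2 / (f h).im)
  rw [mul_assoc, div_mul_cancel₀ _ him] at hlarge
  nlinarith [sq_pos_of_ne_zero him, sq_nonneg ‖h‖]

variable [PartialOrder B] [StarOrderedRing B]

lemma apply_nonneg_of_norm_le_one {x : B} (hx : 0 ≤ x) : 0 ≤ f x := by
  obtain _ | _ := subsingleton_or_nontrivial B
  · simp [Subsingleton.elim x 0]
  have hx' : IsSelfAdjoint x := .of_nonneg hx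
  have hnorm : ‖algebraMap ℝ B ‖x‖ - x‖ ≤ ‖x‖ := by
    simpa using CStarAlgebra.norm_le_norm_of_nonneg_of_le
      (sub_nonneg.2 hx'.le_algebraMap_norm_self) (sub_le_self (algebraMap ℝ B ‖x‖) hx)
  have hle : ‖‖x‖ - f x‖ ≤ ‖x‖ := by
    have hfx : f (algebraMap ℝ B ‖x‖ - x) = ‖x‖ - f x := by
      simp [Algebra.algebraMap_eq_smul_one, ← Complex.coe_smul, hf₁]
    simpa [hfx] using f.le_of_opNorm_le_of_le hf hnorm
  have hre : ‖x‖ - (f x).re ≤ ‖x‖ := by simpa using (Complex.re_le_norm _).trans hle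
  exact Complex.nonneg_iff.2
    ⟨by linarith, (im_apply_eq_zero_of_isSelfAdjoint hf hf₁ hx').symm⟩

end UnitalFunctional

variable [Nontrivial B] [PartialOrder B] [StarOrderedRing B]

lemma norm_one_add_of_nonneg {x : B} (hx : 0 ≤ x) : ‖1 + x‖ = 1 + ‖x‖ := by
  refine le_antisymm ((norm_add_le _ _).trans_eq (by simp)) ?_
  have hmem : 1 + ‖x‖ ∈ spectrum ℝ (1 + x) := by
    simpa [add_comm] using spectrum.add_mem_add_iff (s := (1 : ℝ)).2
      (CStarAlgebra.norm_mem_spectrum_of_nonneg hx)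
  exact (le_abs_self _).trans (by simpa using spectrum.norm_le_norm_of_mem hmem)

lemma exists_unital_apply_eq_norm {x : B} (hx : 0 ≤ x) :
    ∃ f : B →L[ℂ] ℂ, ‖f‖ ≤ 1 ∧ f 1 = 1 ∧ f x = ‖x‖ := by
  obtain ⟨f, hf, hfx⟩ := exists_dual_vector'' ℂ (1 + x)
  have hle (y : B) : ‖f y‖ ≤ ‖y‖ := by simpa using f.le_of_opNorm_le hf y
  rw [map_add, norm_one_add_of_nonneg hx] at hfx
  obtain ⟨h₁, h₂⟩ := eq_ofReal_and_eq_ofReal_of_add_eq ((hle 1).trans_eq norm_one) (hle x) hfx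
  exact ⟨f, hf, by simpa using h₁, h₂⟩

end Unital

section Representation

lemma exists_starAlgHom_norm_apply_eq {B : Type u} [CStarAlgebra B] [Nontrivial B] (c : B) :
    ∃ (H : Type u) (_ : NormedAddCommGroup H) (_ : InnerProductSpace ℂ H) (_ : CompleteSpace H)
      (π : B →⋆ₐ[ℂ] (H →L[ℂ] H)) (ξ : H), ‖ξ‖ = 1 ∧ ‖π c ξ‖ = ‖c‖ := by
  let _ : PartialOrder B := CStarAlgebra.spectralOrder B
  have : StarOrderedRing B := CStarAlgebra.spectralOrderedRing B
  obtain ⟨f, hf, hf₁, hfc⟩ := exists_unital_apply_eq_norm (star_mul_self_nonneg c)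
  let g : B →ₚ[ℂ] ℂ := .mk₀ f.toLinearMap fun x hx ↦ apply_nonneg_of_norm_le_one hf hf₁ hx
  have hg (x : B) : g x = f x := rfl
  refine ⟨g.GNS, inferInstance, inferInstance, inferInstance, g.gnsStarAlgHom,
    (g.toPreGNS 1 : g.PreGNS), ?_, ?_⟩
  · simp [g.preGNS_norm_def, hg, hf₁]
  · simp [g.preGNS_norm_def, hg, hfc, CStarRing.norm_star_mul_self]

variable {A : Type u} [NonUnitalCStarAlgebra A]

theorem exists_representation_norm_apply_eq (c : A) :
    ∃ (H : Type (max u v)) (_ : NormedAddCommGroup H) (_ : InnerProductSpace ℂ H)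
      (_ : CompleteSpace H) (π : A →⋆ₙₐ[ℂ] (H →L[ℂ] H)) (ξ : H), ‖ξ‖ = 1 ∧ ‖π c ξ‖ = ‖c‖ := by
  obtain ⟨H, _, _, _, π, ξ, hξ, hc⟩ := exists_starAlgHom_norm_apply_eq (c : Unitization ℂ A)
  let e : H ≃ₗᵢ[ℂ] ULift.{v} H := (LinearIsometryEquiv.ulift ℂ H).symm
  let π' : A →⋆ₙₐ[ℂ] (H →L[ℂ] H) :=
    (π : Unitization ℂ A →⋆ₙₐ[ℂ] (H →L[ℂ] H)).comp (Unitization.inrNonUnitalStarAlgHom ℂ A)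
  refine ⟨ULift.{v} H, inferInstance, inferInstance, inferInstance,
    (e.conjStarAlgEquiv : (H →L[ℂ] H) →⋆ₙₐ[ℂ] (ULift.{v} H →L[ℂ] ULift.{v} H)).comp π',
    e ξ, by rw [e.norm_map, hξ], ?_⟩
  simpa [π', Unitization.norm_inr] using hc

end Representation

section VectorState

variable {A H : Type*} [NonUnitalCStarAlgebra A] [NormedAddCommGroup H] [InnerProductSpace ℂ H]
  [CompleteSpace H] (π : A →⋆ₙₐ[ℂ] (H →L[ℂ] H)) (ξ : H)

lemma norm_representation_apply_le (x : A) : ‖π x ξ‖ ≤ ‖ξ‖ * ‖x‖ := by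
  rw [mul_comm]
  exact (π x).le_of_opNorm_le (NonUnitalStarAlgHom.norm_apply_le π x) ξ

/-- The orbit map `x ↦ π x ξ` of a vector `ξ` under a representation `π`, through which statements
about a representation become statements about a linear map into a Hilbert space. -/
noncomputable def orbitMap : A →L[ℂ] H :=
  ((ContinuousLinearMap.apply ℂ H ξ).toLinearMap ∘ₗ (π : A →ₗ[ℂ] H →L[ℂ] H)).mkContinuous ‖ξ‖
    (norm_representation_apply_le π ξ)

/-- The vector functional `x ↦ ⟪ξ, π x ξ⟫` of a vector `ξ` in a representation `π`, which is the
source of the states constructed here. -/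
noncomputable def vectorFunctional : A →L[ℂ] ℂ :=
  innerSL ℂ ξ ∘L orbitMap π ξ

@[simp]
lemma orbitMap_apply (x : A) : orbitMap π ξ x = π x ξ := rfl

lemma norm_orbitMap_apply_le {ξ : H} (hξ : ‖ξ‖ = 1) (x : A) : ‖orbitMap π ξ x‖ ≤ ‖x‖ := by
  simpa [hξ] using norm_representation_apply_le π ξ x

lemma vectorFunctional_star_mul (x y : A) :
    vectorFunctional π ξ (star x * y) = inner ℂ (π x ξ) (π y ξ) := by
  calc vectorFunctional π ξ (star x * y) = inner ℂ ξ (star (π x) (π y ξ)) := by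
        simp [vectorFunctional, map_star]
    _ = inner ℂ (π x ξ) (π y ξ) := ContinuousLinearMap.adjoint_inner_right _ _ _

lemma vectorFunctional_star_mul_self (x : A) :
    vectorFunctional π ξ (star x * x) = (‖π x ξ‖ ^ 2 : ℝ) := by
  rw [vectorFunctional_star_mul, inner_self_eq_norm_sq_to_K]
  norm_cast

variable {π ξ}

lemma isState_vectorFunctional (hξ : ‖ξ‖ = 1) {c : A} (hc₀ : c ≠ 0) (hc : ‖π c ξ‖ = ‖c‖) :
    IsState (vectorFunctional π ξ) := by
  have hle (x : A) : ‖vectorFunctional π ξ x‖ ≤ 1 * ‖x‖ := by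
    calc ‖vectorFunctional π ξ x‖ ≤ ‖ξ‖ * ‖orbitMap π ξ x‖ := norm_inner_le_norm _ _
      _ ≤ 1 * ‖x‖ := by rw [hξ]; gcongr; exact norm_orbitMap_apply_le π hξ x
  refine ⟨le_antisymm (ContinuousLinearMap.opNorm_le_bound _ zero_le_one hle) ?_, fun x ↦ ?_⟩
  · have hnorm := (vectorFunctional π ξ).le_opNorm (star c * c)
    rw [vectorFunctional_star_mul_self, hc, CStarRing.norm_star_mul_self, Complex.norm_real,
      Real.norm_of_nonneg (sq_nonneg _), ← sq] at hnorm
    exact (le_mul_iff_one_le_left (by positivity)).1 hnorm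
  · rw [vectorFunctional_star_mul_self]
    exact_mod_cast sq_nonneg ‖π x ξ‖

end VectorState

section Equivalence

variable {A : Type u} [NonUnitalCStarAlgebra A]

lemma exists_isState [Nontrivial A] : ∃ φ : A →L[ℂ] ℂ, IsState φ := by
  obtain ⟨c, hc₀⟩ := exists_ne (0 : A)
  obtain ⟨H, _, _, _, π, ξ, hξ, hc⟩ := exists_representation_norm_apply_eq.{u, u} c
  exact ⟨vectorFunctional π ξ, isState_vectorFunctional hξ hc₀ hc⟩

lemma parallel_of_apply_star_mul_eq {φ : A →L[ℂ] ℂ} (hφ : ‖φ‖ ≤ 1)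
    (hpos : ∀ c, 0 ≤ φ (star c * c)) {a b : A} {l : ℂ} (hl : ‖l‖ = 1)
    (h : φ (star a * b) = l * ‖a‖ * ‖b‖) : Parallel a b := by
  let _ : PartialOrder A := CStarAlgebra.spectralOrder A
  have : StarOrderedRing A := CStarAlgebra.spectralOrderedRing A
  let f : A →ₚ[ℂ] ℂ := .mk₀ φ.toLinearMap fun x hx ↦ by
    obtain ⟨y, rfl⟩ := CStarAlgebra.nonneg_iff_eq_star_mul_self.1 hx
    exact hpos y
  have hcontr (x : A) : ‖f.toPreGNS x‖ ≤ ‖x‖ := by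
    rw [f.preGNS_norm_def, Real.sqrt_le_left (norm_nonneg x), sq, ← CStarRing.norm_star_mul_self]
    exact (Complex.re_le_norm _).trans ((φ.le_of_opNorm_le hφ _).trans_eq (one_mul _))
  exact parallel_of_inner_map_eq hcontr hl h

end Equivalence

end CStarParallel

/- In the third clause `inner ℂ (π b ξ) (π a ξ)` is `(π(a)ξ | π(b)ξ)`, the inner product `(· | ·)`
being linear in its first variable and Mathlib's in its second. A representation is a
⋆-homomorphism into the bounded operators of a Hilbert space, possibly degenerate. -/
theorem mainTheorem8 {A : Type u} [NonUnitalCStarAlgebra A] [Nontrivial A] (a b : A) :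
    List.TFAE [
      CStarParallel.Parallel a b,
      ∃ (φ : A →L[ℂ] ℂ) (l : ℂ), CStarParallel.IsState φ ∧ ‖l‖ = 1 ∧
        φ (star a * b) = l * ‖a‖ * ‖b‖,
      ∃ (H : Type (max u v)) (_ : NormedAddCommGroup H) (_ : InnerProductSpace ℂ H)
        (_ : CompleteSpace H) (π : A →⋆ₙₐ[ℂ] (H →L[ℂ] H)) (ξ : H) (l : ℂ),
        ‖ξ‖ = 1 ∧ ‖l‖ = 1 ∧ ‖π a ξ‖ = ‖a‖ ∧
          inner ℂ (π b ξ) (π a ξ) = l * ‖a‖ * ‖b‖] := by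
  tfae_have 1 → 3 := by
    rintro ⟨l, hl, hab⟩
    obtain ⟨H, _, _, _, π, ξ, hξ, hc⟩ :=
      CStarParallel.exists_representation_norm_apply_eq.{u, v} (a + l • b)
    obtain ⟨ha, hinner⟩ := CStarParallel.norm_map_eq_and_inner_map_eq_of_norm_map_add_smul
      (CStarParallel.norm_orbitMap_apply_le π hξ) hl (hc.trans hab)
    exact ⟨H, _, _, _, π, ξ, l, hξ, hl, ha, hinner⟩
  tfae_have 3 → 2 := by
    rintro ⟨H, _, _, _, π, ξ, l, hξ, hl, ha, hab⟩
    obtain rfl | ha₀ := eq_or_ne a 0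
    · obtain ⟨φ, hφ⟩ := CStarParallel.exists_isState (A := A)
      exact ⟨φ, 1, hφ, norm_one, by simp⟩
    · refine ⟨CStarParallel.vectorFunctional π ξ, star l,
        CStarParallel.isState_vectorFunctional hξ ha₀ ha, by rw [norm_star, hl], ?_⟩
      rw [CStarParallel.vectorFunctional_star_mul, ← inner_conj_symm, hab]
      simp
  tfae_have 2 → 1 := by
    rintro ⟨φ, l, hφ, hl, hab⟩
    exact CStarParallel.parallel_of_apply_star_mul_eq hφ.1.le hφ.2 hl hab
  tfae_finish
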